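/- Let $v_x,m,I_z,l_i,F_{zi},L_i,\sigma_i>0$ and $\phi_i\in(0,1]$, $\psi_i\in[0,1)$ with $\phi_i+\psi_i=1$ ($i=1,2$), and set $$A_2=2\begin{bmatrix}\phi_1&\phi_1l_1\\ \phi_2&-\phi_2l_2\end{bmatrix},\quad G=-\begin{bmatrix}\frac1m&\frac1m\\ \frac{l_1}{I_z}&-\frac{l_2}{I_z}\end{bmatrix},\quad \Lambda=\begin{bmatrix}\frac{v_x}{L_1}&0\\0&\frac{v_x}{L_2}\end{bmatrix},$$ $$K_1=\begin{bmatrix}F_{z1}\sigma_1&0\\0&F_{z2}\sigma_2\end{bmatrix},\quad K_2=v_x\begin{bmatrix}\frac{\psi_1}{L_1}&0\\0&\frac{\psi_2}{L_2}\end{bmatrix},\quad C_1=\begin{bmatrix}0&1\end{bmatrix},\quad C_2=-\begin{bmatrix}\frac1m&\frac1m\end{bmatrix},$$ $\mathscr K_1\zeta=\int_0^1K_1\zeta(\xi)\,d\xi$ and $\mathscr K_2\zeta=K_2\zeta(1)$. Let $\mathcal X=\mathbb R^2\times L^2((0,1);\mathbb R^2)$ and $\mathcal Y=\mathbb R^2\times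 H^1((0,1);\mathbb R^2)$ with $\|(Z,\zeta)\|_{\mathcal X}^2=\|Z\|_2^2+\|\zeta\|_{L^2}^2$ and $\|(Z,\zeta)\|_{\mathcal Y}^2=\|Z\|_2^2+\|\zeta\|_{H^1}^2$. Let the injection operator be $(\mathcal H*\tilde Y)(t)=D\,\tilde Y(t)+\int_0^tH(t-t')\tilde Y(t')\,dt'$, where $D$ is a constant real $2\times2$ matrix (possibly $0$) and $H:[0,\infty)\to\mathbb R^{2\times2}$ is locally integrable. Let $(\tilde X_0,\tilde z_0)\in\mathcal Y$ with $\tilde z_0(0)=0$, and let $(\tilde X,\tilde z)\in C^1([0,\infty);\mathcal X)\cap C^0([0,\infty);\mathcal Y)$ be a classical solution, with initial condition $(\tilde X(0),\tilde z(\cdot,0))=(\tilde X_0,\tilde z_0)$, of the error dynamics $$\dot{\tilde X}(t)=G(\mathscr K_1\tilde z)(t)+(\mathcal H*\tilde Y)(t),\qquad \partial_t\tilde z(\xi,t)+\Lambda\,\partial_\xi\tilde z(\xi,t)=(\mathscr K_2\tilde z)(t)+A_2\tilde X(t),\qquad \tilde z(0,t)=0,$$ for $t>0$, $\xi\in(0,1)$,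 where $\tilde Y(t)=\bigl(C_1\tilde X(t),\,C_2(\mathscr K_1\tilde z)(t)\bigr)^{\mathrm T}$. If $\tilde X(t)\to0$ exponentially fast, i.e. there are $M$ and $\alpha>0$ with $\|\tilde X(t)\|_2\le Me^{-\alpha t}$ for all $t\ge0$, then $\|(\tilde X(t),\tilde z(\cdot,t))\|_{\mathcal X}\to0$ exponentially fast, i.e. there are $M'$ and $\alpha'>0$ with $\|(\tilde X(t),\tilde z(\cdot,t))\|_{\mathcal X}\le M'e^{-\alpha't}$ for all $t\ge0$. -/

import Mathlib

open MeasureTheory Set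
open scoped ContDiff

namespace SingleTrack

/-! ### Function spaces on the unit interval -/

/-- `ℝ²` with the Euclidean norm. -/
abbrev R2 : Type := EuclideanSpace ℝ (Fin 2)

/-- Lebesgue measure on the open interval `(0,1)`. -/
noncomputable abbrev mu : Measure ℝ := (volume : Measure ℝ).restrict (Ioo (0 : ℝ) 1)

/-- `L²((0,1);ℝ²)`. -/
noncomputable abbrev L2 : Type := Lp R2 2 mu

/-- `g` is the weak derivative of `f` on `(0,1)`. -/
def IsWeakDeriv (f g : L2) : Prop :=
  ∀ φ : ℝ → ℝ, ContDiff ℝ ∞ φ → HasCompactSupport φ → tsupport φ ⊆ Ioo (0 : ℝ) 1 →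
    ∫ x, deriv φ x • f x ∂mu = -∫ x, φ x • g x ∂mu

theorem integrable_test_smul {φ : ℝ → ℝ} (hφ : Continuous φ) (hc : HasCompactSupport φ)
    (f : L2) : Integrable (fun x => φ x • f x) mu := by
  have hf : Integrable f mu := (Lp.memLp f).integrable (by norm_num)
  obtain ⟨C, hC⟩ := hc.exists_bound_of_continuous hφ
  exact hf.bdd_smul C hφ.aestronglyMeasurable (Filter.Eventually.of_forall hC)

/-- `H¹((0,1);ℝ²)`: a function of `L²((0,1);ℝ²)` together with its (unique) weak derivative, which
is again in `L²((0,1);ℝ²)`. The norm inherited from `WithLp 2` is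
`‖ζ‖² = ‖ζ‖²_{L²} + ‖∂ζ‖²_{L²}`. -/
def H1 : Submodule ℝ (WithLp 2 (L2 × L2)) where
  carrier := {p | IsWeakDeriv p.fst p.snd}
  zero_mem' := by
    intro φ _ _ _
    have h : ∀ᵐ x ∂mu, (0 : L2) x = 0 := Lp.coeFn_zero R2 2 mu
    have h1 : ∫ x, deriv φ x • (0 : L2) x ∂mu = 0 := by
      apply integral_eq_zero_of_ae
      filter_upwards [h] with x hx
      rw [hx, smul_zero]; rfl
    have h2 : ∫ x, φ x • (0 : L2) x ∂mu = 0 := by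
      apply integral_eq_zero_of_ae
      filter_upwards [h] with x hx
      rw [hx, smul_zero]; rfl
    change ∫ x, deriv φ x • (0 : L2) x ∂mu = -∫ x, φ x • (0 : L2) x ∂mu
    rw [h1, h2, neg_zero]
  add_mem' := by
    intro a b ha hb φ h1 h2 h3
    have e : ∀ (ψ : ℝ → ℝ), Continuous ψ → HasCompactSupport ψ → ∀ f g : L2,
        ∫ x, ψ x • (f + g : L2) x ∂mu = ∫ x, ψ x • f x ∂mu + ∫ x, ψ x • g x ∂mu := by
      intro ψ hψ hψc f g
      rw [← integral_add (integrable_test_smul hψ hψc f) (integrable_test_smul hψ hψc g)]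
      apply integral_congr_ae
      filter_upwards [Lp.coeFn_add f g] with x hx
      rw [hx, Pi.add_apply, smul_add]
    have hd : Continuous (deriv φ) := h1.continuous_deriv (by norm_num)
    change ∫ x, deriv φ x • (a.fst + b.fst : L2) x ∂mu = -∫ x, φ x • (a.snd + b.snd : L2) x ∂mu
    rw [e _ hd h2.deriv, e _ h1.continuous h2, ha φ h1 h2 h3, hb φ h1 h2 h3, neg_add]
  smul_mem' := by
    intro c a ha φ h1 h2 h3
    have e : ∀ (ψ : ℝ → ℝ) (f : L2),
        ∫ x, ψ x • (c • f : L2) x ∂mu = c • ∫ x, ψ x • f x ∂mu := by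
      intro ψ f
      rw [← integral_smul]
      apply integral_congr_ae
      filter_upwards [Lp.coeFn_smul c f] with x hx
      rw [hx, Pi.smul_apply, smul_comm]
    change ∫ x, deriv φ x • (c • a.fst : L2) x ∂mu = -∫ x, φ x • (c • a.snd : L2) x ∂mu
    rw [e, e, ha φ h1 h2 h3, smul_neg]

/-- The underlying `L²` function of an `H¹` function. -/
noncomputable def toL2 (ζ : H1) : L2 := (ζ : WithLp 2 (L2 × L2)).fst

/-- The weak derivative `∂ζ/∂ξ` of an `H¹` function. -/
noncomputable def dxi (ζ : H1) : L2 := (ζ : WithLp 2 (L2 × L2)).snd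

theorem integral_deriv_smul_primitive (g : L2) {φ : ℝ → ℝ} (h1 : ContDiff ℝ ∞ φ)
    (h2 : HasCompactSupport φ) (h3 : tsupport φ ⊆ Ioo (0 : ℝ) 1) :
    ∫ x, deriv φ x • (∫ y, (Iio x).indicator (fun y => g y) y ∂mu) ∂mu
      = -∫ x, φ x • g x ∂mu := by
  have hg : Integrable g mu := (Lp.memLp g).integrable (by norm_num)
  have hd : Continuous (deriv φ) := h1.continuous_deriv (by norm_num)
  obtain ⟨C, hC⟩ := h2.deriv.exists_bound_of_continuous hd
  have hφ1 : φ 1 = 0 := image_eq_zero_of_notMem_tsupport fun h => lt_irrefl _ (h3 h).2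
  have hmeas : MeasurableSet {p : ℝ × ℝ | p.2 < p.1} :=
    measurableSet_lt measurable_snd measurable_fst
  have key : Integrable (Function.uncurry fun x y =>
      deriv φ x • (Iio x).indicator (fun y => g y) y) (mu.prod mu) := by
    have e : (Function.uncurry fun x y => deriv φ x • (Iio x).indicator (fun y => g y) y)
        = {p : ℝ × ℝ | p.2 < p.1}.indicator (fun p => deriv φ p.1 • g p.2) := by
      ext1 ⟨x, y⟩
      by_cases h : y < x <;> simp [Function.uncurry, indicator, h]
    rw [e]
    refine Integrable.indicator ?_ hmeas
    exact (hg.comp_snd mu).bdd_smul C (hd.comp continuous_fst).aestronglyMeasurable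
      (Filter.Eventually.of_forall fun p => hC p.1)
  calc ∫ x, deriv φ x • (∫ y, (Iio x).indicator (fun y => g y) y ∂mu) ∂mu
      = ∫ x, ∫ y, deriv φ x • (Iio x).indicator (fun y => g y) y ∂mu ∂mu := by
        simp_rw [integral_smul]
    _ = ∫ y, ∫ x, deriv φ x • (Iio x).indicator (fun y => g y) y ∂mu ∂mu :=
        integral_integral_swap key
    _ = ∫ y, -(φ y • g y) ∂mu := by
        apply setIntegral_congr_fun measurableSet_Ioo
        intro y hy
        have e : (fun x => deriv φ x • (Iio x).indicator (fun y => g y) y)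
            = fun x => (Ioi y).indicator (deriv φ) x • g y := by
          ext1 x
          by_cases h : y < x <;> simp [indicator, h]
        have hs : Ioi y ∩ Ioo (0 : ℝ) 1 = Ioo y 1 := by
          ext x
          simp only [mem_inter_iff, mem_Ioi, mem_Ioo]
          exact ⟨fun h => ⟨h.1, h.2.2⟩, fun h => ⟨h.1, hy.1.trans h.1, h.2⟩⟩
        simp only [e]
        rw [integral_smul_const, integral_indicator measurableSet_Ioi,
          Measure.restrict_restrict measurableSet_Ioi, hs, ← integral_Ioc_eq_integral_Ioo,
          ← intervalIntegral.integral_of_le hy.2.le,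
          intervalIntegral.integral_deriv_eq_sub
            (fun x _ => h1.differentiable (by norm_num) x) (hd.intervalIntegrable _ _),
          hφ1, zero_sub, neg_smul]
    _ = -∫ x, φ x • g x ∂mu := integral_neg _

/-- A function on `(0,1)` whose weak derivative vanishes is constant. -/
theorem ae_const_of_weakDeriv_zero {u : ℝ → R2} (hu : Integrable u mu)
    (h : ∀ φ : ℝ → ℝ, ContDiff ℝ ∞ φ → HasCompactSupport φ → tsupport φ ⊆ Ioo (0 : ℝ) 1 →
      ∫ x, deriv φ x • u x ∂mu = 0) :
    ∃ c : R2, ∀ᵐ x ∂mu, u x = c := by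
  let b : ContDiffBump (1 / 2 : ℝ) := ⟨1 / 8, 1 / 4, by norm_num, by norm_num⟩
  let ρ : ℝ → ℝ := b.normed volume
  have hρ : ContDiff ℝ ∞ ρ := b.contDiff_normed
  have hρc : HasCompactSupport ρ := b.hasCompactSupport_normed
  have hρs : tsupport ρ = Metric.closedBall (1 / 2 : ℝ) (1 / 4) := b.tsupport_normed_eq
  have hρi : ∫ x, ρ x = 1 := b.integral_normed
  have hint : ∀ ψ : ℝ → ℝ, Continuous ψ → HasCompactSupport ψ →
      Integrable (fun x => ψ x • u x) mu := by
    intro ψ hψ hψc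
    obtain ⟨C, hC⟩ := hψc.exists_bound_of_continuous hψ
    exact hu.bdd_smul C hψ.aestronglyMeasurable (Filter.Eventually.of_forall hC)
  refine ⟨∫ x, ρ x • u x ∂mu, ?_⟩
  set c := ∫ x, ρ x • u x ∂mu with hc
  have hmain : ∀ᵐ x ∂mu, x ∈ Ioo (0 : ℝ) 1 → u x - c = 0 := by
    refine IsOpen.ae_eq_zero_of_integral_contDiff_smul_eq_zero isOpen_Ioo
      ((hu.sub (integrable_const c)).locallyIntegrable.locallyIntegrableOn _) ?_
    intro ψ h1 h2 h3
    set I := ∫ x, ψ x with hI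
    have hψmu : ∫ x, ψ x ∂mu = I := by
      apply setIntegral_eq_integral_of_forall_compl_eq_zero
      intro x hx
      exact image_eq_zero_of_notMem_tsupport fun hm => hx (h3 hm)
    let χ : ℝ → ℝ := fun x => ψ x - I * ρ x
    have hχ : ContDiff ℝ ∞ χ := h1.sub (contDiff_const.mul hρ)
    let K : Set ℝ := tsupport ψ ∪ tsupport ρ
    have hK : IsCompact K := IsCompact.union h2 hρc
    have hKne : K.Nonempty := by
      refine ⟨1 / 2, Or.inr ?_⟩
      rw [hρs]
      exact Metric.mem_closedBall_self (by norm_num)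
    have hKs : K ⊆ Ioo (0 : ℝ) 1 := by
      refine union_subset h3 ?_
      rw [hρs, Real.closedBall_eq_Icc]
      intro x hx
      exact ⟨by linarith [hx.1], by linarith [hx.2]⟩
    obtain ⟨a, ha⟩ := hK.exists_isLeast hKne
    obtain ⟨d, hd⟩ := hK.exists_isGreatest hKne
    have ha0 := hKs ha.1
    have hd0 := hKs hd.1
    have hχ0 : ∀ x, x ∉ Icc a d → χ x = 0 := by
      intro x hx
      have hxK : x ∉ K := fun hm => hx ⟨ha.2 hm, hd.2 hm⟩
      have hx1 : ψ x = 0 := image_eq_zero_of_notMem_tsupport fun hm => hxK (Or.inl hm)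
      have hx2 : ρ x = 0 := image_eq_zero_of_notMem_tsupport fun hm => hxK (Or.inr hm)
      simp [χ, hx1, hx2]
    have hχI : ∫ x, χ x = 0 := by
      simp only [χ]
      rw [integral_sub (h1.continuous.integrable_of_hasCompactSupport h2)
        ((hρ.continuous.integrable_of_hasCompactSupport hρc).const_mul I),
        integral_const_mul, hρi]
      simp [hI]
    let φ : ℝ → ℝ := fun x => ∫ y in (0 : ℝ)..x, χ y
    have hφd : ∀ x, HasDerivAt φ (χ x) x := fun x =>
      hχ.continuous.integral_hasStrictDerivAt 0 x |>.hasDerivAt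
    have hφd' : deriv φ = χ := funext fun x => (hφd x).deriv
    have hφs : ContDiff ℝ ∞ φ := by
      rw [contDiff_infty_iff_deriv, hφd']
      exact ⟨fun x => (hφd x).differentiableAt, hχ⟩
    have hφ0 : ∀ x, x ∉ Icc a d → φ x = 0 := by
      intro x hx
      rcases lt_or_ge x a with hxa | hxa
      · refine intervalIntegral.integral_zero_ae (Filter.Eventually.of_forall fun y hy => ?_)
        apply hχ0
        intro hm
        have : y ≤ max 0 x := hy.2
        have : y < a := this.trans_lt (max_lt ha0.1 hxa)
        exact absurd hm.1 (not_le.2 this)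
      · have hxd : d < x := by
          by_contra hcon
          exact hx ⟨hxa, not_lt.1 hcon⟩
        have : ∫ y, χ y = φ x := by
          simp only [φ]
          rw [intervalIntegral.integral_of_le (hd0.1.trans hxd).le]
          symm
          apply setIntegral_eq_integral_of_forall_compl_eq_zero
          intro y hy
          apply hχ0
          intro hm
          exact hy ⟨ha0.1.trans_le hm.1, hm.2.trans hxd.le⟩
        rw [← this, hχI]
    have hφt : tsupport φ ⊆ Icc a d := by
      refine closure_minimal (fun x hx => ?_) isClosed_Icc
      by_contra hcon
      exact hx (hφ0 x hcon)
    have hφc : HasCompactSupport φ :=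
      isCompact_Icc.of_isClosed_subset (isClosed_tsupport φ) hφt
    have h0 := h φ hφs hφc (hφt.trans fun x hx => ⟨ha0.1.trans_le hx.1, hx.2.trans_lt hd0.2⟩)
    rw [hφd'] at h0
    have e1 : ∫ x, χ x • u x ∂mu = ∫ x, ψ x • u x ∂mu - I • c := by
      have : (fun x => χ x • u x) = fun x => ψ x • u x - I • (ρ x • u x) := by
        ext1 x
        simp only [χ, sub_smul, mul_smul]
      have hρI : Integrable (fun x => I • ρ x • u x) mu := (hint ρ hρ.continuous hρc).smul I
      rw [this, integral_sub (hint ψ h1.continuous h2) hρI, integral_smul]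
    have e2 : ∫ x, ψ x • (u x - c) ∂mu = ∫ x, ψ x • u x ∂mu - I • c := by
      simp_rw [smul_sub]
      rw [integral_sub (hint ψ h1.continuous h2)
        (((h1.continuous.integrable_of_hasCompactSupport h2).integrableOn).smul_const c),
        integral_smul_const, hψmu]
    rw [e2, ← e1, h0]
  have hmem : ∀ᵐ x ∂mu, x ∈ Ioo (0 : ℝ) 1 := ae_restrict_mem measurableSet_Ioo
  filter_upwards [hmain, hmem] with x hx hm
  exact sub_eq_zero.1 (hx hm)

/-- Every `H¹` function on `(0,1)` has a representative that is continuous on `[0,1]`. -/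
theorem exists_continuous_rep (ζ : H1) :
    ∃ f : ℝ → R2, ContinuousOn f (Icc 0 1) ∧ ∀ᵐ x ∂mu, toL2 ζ x = f x := by
  have hf : Integrable (toL2 ζ) mu := (Lp.memLp (toL2 ζ)).integrable (by norm_num)
  have hg : Integrable (dxi ζ) mu := (Lp.memLp (dxi ζ)).integrable (by norm_num)
  let G : ℝ → R2 := fun x => ∫ y, (Iio x).indicator (fun y => dxi ζ y) y ∂mu
  have hGe : ∀ x ∈ Icc (0 : ℝ) 1, G x = ∫ y in (0 : ℝ)..x, dxi ζ y := by
    intro x hx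
    have hs : Iio x ∩ Ioo (0 : ℝ) 1 = Ioo 0 x := by
      ext y
      simp only [mem_inter_iff, mem_Iio, mem_Ioo]
      exact ⟨fun h => ⟨h.2.1, h.1⟩, fun h => ⟨h.2, h.1, h.2.trans_le hx.2⟩⟩
    simp only [G]
    rw [integral_indicator measurableSet_Iio, Measure.restrict_restrict measurableSet_Iio, hs,
      intervalIntegral.integral_of_le hx.1, integral_Ioc_eq_integral_Ioo]
  have hGc : ContinuousOn G (Icc 0 1) := by
    refine ContinuousOn.congr ?_ hGe
    rw [← uIcc_of_le (zero_le_one' ℝ)]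
    apply intervalIntegral.continuousOn_primitive_interval
    rw [uIcc_of_le zero_le_one, integrableOn_Icc_iff_integrableOn_Ioo]
    exact hg
  have hGi : Integrable G mu :=
    (hGc.integrableOn_Icc (μ := volume)).mono_set Ioo_subset_Icc_self
  obtain ⟨c, hc⟩ := ae_const_of_weakDeriv_zero (hf.sub hGi) (by
    intro φ h1 h2 h3
    have hd : Continuous (deriv φ) := h1.continuous_deriv (by norm_num)
    obtain ⟨C, hC⟩ := h2.deriv.exists_bound_of_continuous hd
    have e : ∫ x, deriv φ x • toL2 ζ x ∂mu = -∫ x, φ x • dxi ζ x ∂mu := ζ.2 φ h1 h2 h3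
    have e' : ∫ x, deriv φ x • G x ∂mu = -∫ x, φ x • dxi ζ x ∂mu :=
      integral_deriv_smul_primitive (dxi ζ) h1 h2 h3
    have hGφ : Integrable (fun x => deriv φ x • G x) mu :=
      hGi.bdd_smul C hd.aestronglyMeasurable (Filter.Eventually.of_forall hC)
    simp only [Pi.sub_apply, smul_sub]
    rw [integral_sub (integrable_test_smul hd h2.deriv _) hGφ, e, e', sub_self])
  refine ⟨fun x => G x + c, hGc.add continuousOn_const, ?_⟩
  filter_upwards [hc] with x hx
  rw [← hx]
  simp

/-- The value `ζ(x)`, `x ∈ [0,1]`, of an `H¹` function: the value at `x` of its representative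
that is continuous on `[0,1]` (unique there). -/
noncomputable def evalAt (ζ : H1) (x : ℝ) : R2 := (exists_continuous_rep ζ).choose x

/-- The state space `𝒳 = ℝ² × L²((0,1);ℝ²)`, with `‖(Z,ζ)‖² = ‖Z‖² + ‖ζ‖²_{L²}`. -/
noncomputable abbrev StateX : Type := WithLp 2 (R2 × L2)

/-- The space `𝒴 = ℝ² × H¹((0,1);ℝ²)`, with `‖(Z,ζ)‖² = ‖Z‖² + ‖ζ‖²_{H¹}`. -/
noncomputable abbrev StateY : Type := WithLp 2 (R2 × H1)

/-- The inclusion `𝒴 ⊆ 𝒳`. -/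
noncomputable def incl (u : StateY) : StateX := WithLp.toLp 2 (u.fst, toL2 u.snd)

/-- A matrix acting on vectors of `ℝ²`. -/
noncomputable abbrev act (A : Matrix (Fin 2) (Fin 2) ℝ) : R2 →L[ℝ] R2 :=
  Matrix.toEuclideanCLM (𝕜 := ℝ) A

/-! ### The single-track model with distributed tires -/

/-- The physical parameters of the model. -/
structure Params where
  /-- longitudinal speed -/
  vx : ℝ
  /-- vehicle mass -/
  m : ℝ
  /-- vertical moment of inertia -/
  Iz : ℝ
  /-- front and rear axle lengths -/
  l₁ : ℝ
  l₂ : ℝ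
  /-- front and rear vertical forces -/
  Fz₁ : ℝ
  Fz₂ : ℝ
  /-- front and rear contact patch lengths -/
  L₁ : ℝ
  L₂ : ℝ
  /-- front and rear normalized micro-stiffnesses -/
  σ₁ : ℝ
  σ₂ : ℝ
  /-- structural parameters of the tire carcasses -/
  φ₁ : ℝ
  φ₂ : ℝ
  ψ₁ : ℝ
  ψ₂ : ℝ
  vx_pos : 0 < vx
  m_pos : 0 < m
  Iz_pos : 0 < Iz
  l₁_pos : 0 < l₁
  l₂_pos : 0 < l₂
  Fz₁_pos : 0 < Fz₁
  Fz₂_pos : 0 < Fz₂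
  L₁_pos : 0 < L₁
  L₂_pos : 0 < L₂
  σ₁_pos : 0 < σ₁
  σ₂_pos : 0 < σ₂
  φ₁_mem : φ₁ ∈ Ioc (0 : ℝ) 1
  φ₂_mem : φ₂ ∈ Ioc (0 : ℝ) 1
  ψ₁_mem : ψ₁ ∈ Ico (0 : ℝ) 1
  ψ₂_mem : ψ₂ ∈ Ico (0 : ℝ) 1
  φ_add_ψ₁ : φ₁ + ψ₁ = 1
  φ_add_ψ₂ : φ₂ + ψ₂ = 1

namespace Params

variable (p : Params)

/-- The matrix `A₂`. -/
noncomputable def A2 : Matrix (Fin 2) (Fin 2) ℝ :=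
  (2 : ℝ) • !![p.φ₁, p.φ₁ * p.l₁; p.φ₂, -(p.φ₂ * p.l₂)]

/-- The matrix `G`. -/
noncomputable def G : Matrix (Fin 2) (Fin 2) ℝ :=
  -!![1 / p.m, 1 / p.m; p.l₁ / p.Iz, -(p.l₂ / p.Iz)]

/-- The matrix `Λ` of transport velocities. -/
noncomputable def Lam : Matrix (Fin 2) (Fin 2) ℝ :=
  !![p.vx / p.L₁, 0; 0, p.vx / p.L₂]

/-- The matrix `K₁`. -/
noncomputable def K1mat : Matrix (Fin 2) (Fin 2) ℝ :=
  !![p.Fz₁ * p.σ₁, 0; 0, p.Fz₂ * p.σ₂]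

/-- The matrix `K₂`. -/
noncomputable def K2mat : Matrix (Fin 2) (Fin 2) ℝ :=
  p.vx • !![p.ψ₁ / p.L₁, 0; 0, p.ψ₂ / p.L₂]

/-- The operator `𝒦₁ ζ = ∫₀¹ K₁ ζ(ξ) dξ`. -/
noncomputable def K1 (ζ : L2) : R2 := ∫ x, act p.K1mat (ζ x) ∂mu

/-- The operator `𝒦₂ ζ = K₂ ζ(1)`. -/
noncomputable def K2 (ζ : H1) : R2 := act p.K2mat (evalAt ζ 1)

/-- The row `C₁`, selecting the yaw rate. -/
noncomputable def C1 : Matrix (Fin 1) (Fin 2) ℝ := !![0, 1]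

/-- The row `C₂`. -/
noncomputable def C2 : Matrix (Fin 1) (Fin 2) ℝ := -!![1 / p.m, 1 / p.m]

/-- The output error `(C₁ X, C₂ (𝒦₁ z))` associated with an error state `(X, z)`. -/
noncomputable def output (u : StateX) : R2 :=
  !₂[(C1.mulVec u.fst.ofLp) 0, (p.C2.mulVec (p.K1 u.snd).ofLp) 0]

end Params

/-- The injection operator `(ℋ * Y)(t) = D Y(t) + ∫₀ᵗ H(t - t') Y(t') dt'`, i.e. convolution with the
kernel `D δ₀ + H`; `D = 0` gives convolution with the function `H`. -/
noncomputable def inject (D : Matrix (Fin 2) (Fin 2) ℝ) (H : ℝ → Matrix (Fin 2) (Fin 2) ℝ)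
    (Y : ℝ → R2) (t : ℝ) : R2 :=
  act D (Y t) + ∫ s in (0 : ℝ)..t, act (H (t - s)) (Y s)

/-- The curve `t ↦ u(t) = (X(t), z(·,t))`, `t ≥ 0`, is a classical solution of the error system
`X' = G (𝒦₁ z) + ℋ * Y`, `∂ₜ z + Λ ∂_ξ z = 𝒦₂ z + A₂ X`, `z(0,t) = 0`. -/
structure IsClassicalSolution (p : Params) (D : Matrix (Fin 2) (Fin 2) ℝ)
    (H : ℝ → Matrix (Fin 2) (Fin 2) ℝ) (u : ℝ → StateY) : Prop where
  /-- `u ∈ C⁰([0,∞);𝒴)` -/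
  continuousOn : ContinuousOn u (Ici 0)
  /-- `u ∈ C¹([0,∞);𝒳)` -/
  contDiffOn : ContDiffOn ℝ 1 (fun t => incl (u t)) (Ici 0)
  /-- the ordinary differential equation -/
  ode : ∀ t : ℝ, 0 < t → HasDerivAt (fun r => (u r).fst)
    (act p.G (p.K1 (toL2 (u t).snd)) + inject D H (fun r => p.output (incl (u r))) t) t
  /-- the transport equation, as an identity in `L²((0,1);ℝ²)`; the last term is a constant
  function of `ξ` -/
  pde : ∀ t : ℝ, 0 < t → HasDerivAt (fun r => toL2 (u r).snd)
    (-((act p.Lam).compLp (dxi (u t).snd))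
      + Lp.const 2 mu (p.K2 (u t).snd + act p.A2 (u t).fst)) t
  /-- the boundary condition -/
  bc : ∀ t : ℝ, 0 < t → evalAt (u t).snd 0 = 0

/-- `f(t) → 0` exponentially fast as `t → ∞`. -/
def ExpDecay {E : Type*} [NormedAddCommGroup E] (f : ℝ → E) : Prop :=
  ∃ M α : ℝ, 0 < α ∧ ∀ t : ℝ, 0 ≤ t → ‖f t‖ ≤ M * Real.exp (-(α * t))

end SingleTrack

/-!
Only the transport equation is used, with the exponentially decaying `X` as an input: each
component `y` of `z` solves a scalar equation `y_t + λ y_x = λ ψ y(1,t) + b(t)`, `y(0,t) = 0`, with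
`0 ≤ ψ < 1` and `b` a component of `A₂ X`, and such an equation is exponentially input-to-state
stable (`expDecay_transport`).

The Lyapunov functional is `V = ∫₀¹ w y²` with `w(x) = (x + ε)⁻¹`. As `w' = -w²`, integration by parts
gives `V' = -λ w(1) y(1)² - λ ∫ w² y² + 2 (λ ψ y(1) + b) ∫ w y`, and `(∫ w y)² ≤ ∫ w² y²` by Jensen's
inequality. The quadratic form in `y(1)` and `∫ w y` is negative definite when `ψ² (1 + ε) < 1`, which
holds for small `ε` because `ψ < 1`; hence `V' ≤ -c V + C b²` (`weighted_energy_rate_le`), and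
Gronwall's argument (`ExpDecay.of_hasDerivAt_le`) concludes. Working in `L²` with `V = ‖√w y‖²`, the
hypothesis `y ∈ C¹([0,∞); L²)` makes `V` differentiable, and the trace formula
`evalAt_eq_integral_dxi` turns `y` into the primitive of its weak derivative, so that it may be
integrated by parts.
-/

namespace SingleTrack

/-! ### The trace formula in `H¹` -/

theorem toL2_ae_eq_evalAt (ζ : H1) : ∀ᵐ x ∂mu, toL2 ζ x = evalAt ζ x :=
  (exists_continuous_rep ζ).choose_spec.2

/-- An `H¹` function vanishing at `0` is, on `[0,1]`, the primitive of its weak derivative. -/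
theorem evalAt_eq_integral_dxi {ζ : H1} (h0 : evalAt ζ 0 = 0) {x : ℝ} (hx : x ∈ Icc (0 : ℝ) 1) :
    evalAt ζ x = ∫ y in (0 : ℝ)..x, dxi ζ y := by
  have hcont : ContinuousOn (evalAt ζ) (Icc 0 1) := (exists_continuous_rep ζ).choose_spec.1
  have hae := toL2_ae_eq_evalAt ζ
  have hf : Integrable (toL2 ζ) mu := (Lp.memLp (toL2 ζ)).integrable (by norm_num)
  have hg : Integrable (dxi ζ) mu := (Lp.memLp (dxi ζ)).integrable (by norm_num)
  -- the primitive, in the form used by `integral_deriv_smul_primitive`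
  let G : ℝ → R2 := fun x => ∫ y, (Iio x).indicator (fun y => dxi ζ y) y ∂mu
  have hGe : ∀ x ∈ Icc (0 : ℝ) 1, G x = ∫ y in (0 : ℝ)..x, dxi ζ y := by
    intro x hx
    have hs : Iio x ∩ Ioo (0 : ℝ) 1 = Ioo 0 x := by
      ext y
      simp only [mem_inter_iff, mem_Iio, mem_Ioo]
      exact ⟨fun h => ⟨h.2.1, h.1⟩, fun h => ⟨h.2, h.1, h.2.trans_le hx.2⟩⟩
    simp only [G]
    rw [integral_indicator measurableSet_Iio, Measure.restrict_restrict measurableSet_Iio, hs,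
      intervalIntegral.integral_of_le hx.1, integral_Ioc_eq_integral_Ioo]
  have hGc : ContinuousOn G (Icc 0 1) := by
    refine ContinuousOn.congr ?_ hGe
    rw [← uIcc_of_le (zero_le_one' ℝ)]
    apply intervalIntegral.continuousOn_primitive_interval
    rw [uIcc_of_le zero_le_one, integrableOn_Icc_iff_integrableOn_Ioo]
    exact hg
  have hGi : Integrable G mu :=
    (hGc.integrableOn_Icc (μ := volume)).mono_set Ioo_subset_Icc_self
  obtain ⟨c, hc⟩ := ae_const_of_weakDeriv_zero (hf.sub hGi) (by
    intro φ h1 h2 h3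
    have hd : Continuous (deriv φ) := h1.continuous_deriv (by norm_num)
    obtain ⟨C, hC⟩ := h2.deriv.exists_bound_of_continuous hd
    have e : ∫ x, deriv φ x • toL2 ζ x ∂mu = -∫ x, φ x • dxi ζ x ∂mu := ζ.2 φ h1 h2 h3
    have e' : ∫ x, deriv φ x • G x ∂mu = -∫ x, φ x • dxi ζ x ∂mu :=
      integral_deriv_smul_primitive (dxi ζ) h1 h2 h3
    have hGφ : Integrable (fun x => deriv φ x • G x) mu :=
      hGi.bdd_smul C hd.aestronglyMeasurable (Filter.Eventually.of_forall hC)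
    simp only [Pi.sub_apply, smul_sub]
    rw [integral_sub (integrable_test_smul hd h2.deriv _) hGφ, e, e', sub_self])
  have heq : EqOn (evalAt ζ) (fun x => G x + c) (Icc 0 1) := by
    refine Measure.eqOn_Icc_of_ae_eq volume zero_ne_one ?_ hcont (hGc.add continuousOn_const)
    rw [← restrict_Ioo_eq_restrict_Icc]
    filter_upwards [hae, hc] with x hx hx'
    rw [← hx, ← hx']
    simp
  have hc0 : c = 0 := by
    have h := heq (left_mem_Icc.2 zero_le_one)
    simp only [h0, hGe 0 (left_mem_Icc.2 zero_le_one), intervalIntegral.integral_same,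
      zero_add] at h
    exact h.symm
  rw [heq hx, ← hGe x hx, hc0]
  exact add_zero _

/-! ### Weighted estimates on the unit interval -/

theorem integral_mu_eq_intervalIntegral (f : ℝ → ℝ) : ∫ x, f x ∂mu = ∫ x in (0 : ℝ)..1, f x := by
  rw [intervalIntegral.integral_of_le zero_le_one, integral_Ioc_eq_integral_Ioo]

instance isProbabilityMeasure_mu : IsProbabilityMeasure mu := ⟨by simp⟩

theorem intervalIntegrable_of_integrable_mu {g : ℝ → ℝ} (hg : Integrable g mu) :
    IntervalIntegrable g volume 0 1 := by
  rw [intervalIntegrable_iff_integrableOn_Ioo_of_le zero_le_one]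
  exact hg

theorem absolutelyContinuous_inv_add {ε : ℝ} (hε : 0 < ε) :
    AbsolutelyContinuousOnInterval (fun x => (x + ε)⁻¹) 0 1 := by
  have hne : ∀ x ∈ Icc (0 : ℝ) 1, x + ε ≠ 0 := fun x hx => by linarith [hx.1] |> ne_of_gt
  have hc : ContDiffOn ℝ 1 (fun x : ℝ => (x + ε)⁻¹) (Icc 0 1) :=
    (contDiffOn_id.add contDiffOn_const).inv hne
  obtain ⟨K, hK⟩ := hc.exists_lipschitzOnWith one_ne_zero (convex_Icc 0 1) isCompact_Icc
  exact LipschitzOnWith.absolutelyContinuousOnInterval (by rwa [uIcc_of_le zero_le_one])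

theorem continuousOn_inv_add {ε : ℝ} (hε : 0 < ε) :
    ContinuousOn (fun x => (x + ε)⁻¹) (Icc 0 1) := by
  simpa [uIcc_of_le] using (absolutelyContinuous_inv_add hε).continuousOn

theorem continuousOn_primitive {g : ℝ → ℝ} (hg : Integrable g mu) :
    ContinuousOn (fun x => ∫ s in (0 : ℝ)..x, g s) (Icc 0 1) := by
  simpa [uIcc_of_le] using ((intervalIntegrable_of_integrable_mu hg
    ).absolutelyContinuousOnInterval_intervalIntegral (c := 0) (by simp)).continuousOn

theorem integrable_mu_of_continuousOn {f : ℝ → ℝ} (hf : ContinuousOn f (Icc 0 1)) :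
    Integrable f mu :=
  (hf.integrableOn_Icc (μ := volume)).mono_set Ioo_subset_Icc_self

/-- Integration by parts against the weight `w(x) = (x + ε)⁻¹`, which satisfies `w' = -w²`, for a
primitive `F` of `g` with `F(0) = 0`: the identity `2 ∫ w F F' = w(1) F(1)² + ∫ w² F²`. -/
theorem two_mul_integral_inv_add_mul {ε : ℝ} (hε : 0 < ε) {g : ℝ → ℝ} (hg : Integrable g mu) :
    2 * ∫ x, (x + ε)⁻¹ * (∫ s in (0 : ℝ)..x, g s) * g x ∂mu
      = (1 + ε)⁻¹ * (∫ s in (0 : ℝ)..1, g s) ^ 2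
        + ∫ x, ((x + ε)⁻¹ * ∫ s in (0 : ℝ)..x, g s) ^ 2 ∂mu := by
  have hgi := intervalIntegrable_of_integrable_mu hg
  set F : ℝ → ℝ := fun x => ∫ s in (0 : ℝ)..x, g s with hF
  have hFa : AbsolutelyContinuousOnInterval F 0 1 :=
    hgi.absolutelyContinuousOnInterval_intervalIntegral (by simp)
  have hwa := absolutelyContinuous_inv_add hε
  have key := (hwa.fun_mul (hFa.fun_mul hFa)).integral_deriv_eq_sub
  have hF0 : F 0 = 0 := intervalIntegral.integral_same
  have hcw := continuousOn_inv_add hε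
  have hcF : ContinuousOn F (Icc 0 1) := continuousOn_primitive hg
  have i1 : Integrable (fun x => 2 * ((x + ε)⁻¹ * F x * g x)) mu := by
    have : IntervalIntegrable (fun x => (x + ε)⁻¹ * F x * g x) volume 0 1 :=
      hgi.continuousOn_mul (by rw [uIcc_of_le zero_le_one]; exact hcw.mul hcF)
    rw [intervalIntegrable_iff_integrableOn_Ioo_of_le zero_le_one] at this
    exact Integrable.const_mul this 2
  have i2 : Integrable (fun x => ((x + ε)⁻¹ * F x) ^ 2) mu :=
    integrable_mu_of_continuousOn ((hcw.mul hcF).pow 2)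
  have hder : ∫ x in (0 : ℝ)..1, deriv (fun x => (x + ε)⁻¹ * (F x * F x)) x
      = ∫ x, (2 * ((x + ε)⁻¹ * F x * g x) - ((x + ε)⁻¹ * F x) ^ 2) ∂mu := by
    rw [integral_mu_eq_intervalIntegral]
    apply intervalIntegral.integral_congr_ae
    filter_upwards [hgi.ae_hasDerivAt_integral] with x hx hx1
    have hx2 : x ∈ uIcc (0 : ℝ) 1 := uIoc_subset_uIcc hx1
    have hFd : HasDerivAt F (g x) x := hx hx2 0 (by simp)
    have hne : x + ε ≠ 0 := by
      rw [uIcc_of_le zero_le_one] at hx2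
      linarith [hx2.1] |> ne_of_gt
    have hwd : HasDerivAt (fun x => (x + ε)⁻¹) (-1 / (x + ε) ^ 2) x :=
      ((hasDerivAt_id x).add_const ε).fun_inv hne
    rw [(hwd.fun_mul (hFd.fun_mul hFd)).deriv]
    field_simp
    ring
  rw [hder, integral_sub i1 i2, integral_const_mul, hF0] at key
  rw [show (1 + ε)⁻¹ * (F 1 * F 1) - (0 + ε)⁻¹ * (0 * 0) = (1 + ε)⁻¹ * F 1 ^ 2 by ring] at key
  linarith

/-- Jensen's inequality for the square, on a probability space. -/
theorem sq_integral_le_integral_sq {f : ℝ → ℝ} (hf : Integrable f mu)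
    (hf2 : Integrable (fun x => f x ^ 2) mu) : (∫ x, f x ∂mu) ^ 2 ≤ ∫ x, f x ^ 2 ∂mu :=
  (even_two.convexOn_pow).map_integral_le (continuous_pow 2).continuousOn isClosed_univ
    (Filter.Eventually.of_forall fun _ => mem_univ _) hf hf2

/-! ### The dissipation inequality -/

/-- With `w(x) = (x + ε)⁻¹` and `F(x) = ∫₀ˣ g`, the left-hand side is the rate of change of
`∫ w F²` along the scalar transport equation `F_t = -λ F_x + λ ψ F(1) + b`. Integration by parts
yields `-λ w(1) F(1)² - λ ∫ w² F²`; by Jensen's inequality this dominates the nonlocal term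
`2 λ ψ F(1) ∫ w F` as soon as `ψ² (1 + ε) < 1`. -/
theorem weighted_energy_rate_le {lam ψ ε b : ℝ} (hlam : 0 < lam) (hε : 0 < ε)
    (hδ : 0 < 1 - ψ ^ 2 * (1 + ε)) {g : ℝ → ℝ} (hg : Integrable g mu) :
    2 * ∫ x, (x + ε)⁻¹ * (∫ s in (0 : ℝ)..x, g s)
        * (-(lam * g x) + (lam * ψ * (∫ s in (0 : ℝ)..1, g s) + b)) ∂mu
      ≤ -(lam * (1 - ψ ^ 2 * (1 + ε)) / (2 * (1 + ε)))
          * ∫ x, (x + ε)⁻¹ * (∫ s in (0 : ℝ)..x, g s) ^ 2 ∂mu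
        + 2 / (lam * (1 - ψ ^ 2 * (1 + ε))) * b ^ 2 := by
  have hgi := intervalIntegrable_of_integrable_mu hg
  have hibp := two_mul_integral_inv_add_mul hε hg
  have hcw := continuousOn_inv_add hε
  have hcF := continuousOn_primitive hg
  set F : ℝ → ℝ := fun x => ∫ s in (0 : ℝ)..x, g s with hF
  change _ = (1 + ε)⁻¹ * F 1 ^ 2 + ∫ x, ((x + ε)⁻¹ * F x) ^ 2 ∂mu at hibp
  set δ := 1 - ψ ^ 2 * (1 + ε) with hδd
  set c : ℝ := lam * ψ * F 1 + b with hc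
  have i0 : Integrable (fun x => (x + ε)⁻¹ * F x) mu :=
    integrable_mu_of_continuousOn (hcw.mul hcF)
  have i1 : Integrable (fun x => (x + ε)⁻¹ * F x * g x) mu := by
    have : IntervalIntegrable (fun x => (x + ε)⁻¹ * F x * g x) volume 0 1 :=
      hgi.continuousOn_mul (by rw [uIcc_of_le zero_le_one]; exact hcw.mul hcF)
    rwa [intervalIntegrable_iff_integrableOn_Ioo_of_le zero_le_one] at this
  have i2 : Integrable (fun x => ((x + ε)⁻¹ * F x) ^ 2) mu :=
    integrable_mu_of_continuousOn ((hcw.mul hcF).pow 2)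
  have i3 : Integrable (fun x => (x + ε)⁻¹ * F x ^ 2) mu :=
    integrable_mu_of_continuousOn (hcw.mul (hcF.pow 2))
  have hsplit : ∫ x, (x + ε)⁻¹ * F x * (-(lam * g x) + c) ∂mu
      = -(lam * ∫ x, (x + ε)⁻¹ * F x * g x ∂mu) + c * ∫ x, (x + ε)⁻¹ * F x ∂mu := by
    rw [← integral_const_mul, ← integral_const_mul, ← integral_neg, ← integral_add]
    · exact integral_congr_ae (Filter.Eventually.of_forall fun x => by ring)
    · exact (i1.const_mul lam).neg
    · exact i0.const_mul c
  have hQV : (1 + ε)⁻¹ * ∫ x, (x + ε)⁻¹ * F x ^ 2 ∂mu ≤ ∫ x, ((x + ε)⁻¹ * F x) ^ 2 ∂mu := by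
    rw [← integral_const_mul]
    refine integral_mono_ae (i3.const_mul _) i2 ?_
    filter_upwards [ae_restrict_mem measurableSet_Ioo] with x hx
    have h1 : (1 + ε)⁻¹ ≤ (x + ε)⁻¹ := inv_anti₀ (by linarith [hx.1]) (by linarith [hx.2])
    have h2 : 0 ≤ (x + ε)⁻¹ * F x ^ 2 :=
      mul_nonneg (inv_nonneg.2 (by linarith [hx.1])) (sq_nonneg _)
    calc (1 + ε)⁻¹ * ((x + ε)⁻¹ * F x ^ 2) ≤ (x + ε)⁻¹ * ((x + ε)⁻¹ * F x ^ 2) := by gcongr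
      _ = ((x + ε)⁻¹ * F x) ^ 2 := by ring
  have hm := sq_integral_le_integral_sq i0 i2
  rw [hsplit]
  set m := ∫ x, (x + ε)⁻¹ * F x ∂mu
  set Q := ∫ x, ((x + ε)⁻¹ * F x) ^ 2 ∂mu
  set V := ∫ x, (x + ε)⁻¹ * F x ^ 2 ∂mu
  set J := ∫ x, (x + ε)⁻¹ * F x * g x ∂mu
  have hε1 : 0 < 1 + ε := by linarith
  -- completing the square in the boundary value `F 1`
  have hsq : 2 * ψ * F 1 * m ≤ (1 + ε)⁻¹ * F 1 ^ 2 + ψ ^ 2 * (1 + ε) * m ^ 2 := by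
    have h := mul_nonneg (inv_nonneg.2 hε1.le) (sq_nonneg (F 1 - ψ * (1 + ε) * m))
    have e : (1 + ε)⁻¹ * (F 1 - ψ * (1 + ε) * m) ^ 2
        = (1 + ε)⁻¹ * F 1 ^ 2 + ψ ^ 2 * (1 + ε) * m ^ 2 - 2 * ψ * F 1 * m := by
      field_simp
      ring
    linarith
  have hb : 2 * b * m ≤ lam * δ / 2 * m ^ 2 + 2 / (lam * δ) * b ^ 2 := by
    have hp : 0 < lam * δ := mul_pos hlam hδ
    have h := mul_nonneg (inv_nonneg.2 hp.le) (sq_nonneg (lam * δ * m - 2 * b))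
    have e : (lam * δ)⁻¹ * (lam * δ * m - 2 * b) ^ 2
        = 2 * (lam * δ / 2 * m ^ 2 + 2 / (lam * δ) * b ^ 2 - 2 * b * m) := by
      field_simp
      ring
    linarith
  have hψm : ψ ^ 2 * (1 + ε) * m ^ 2 ≤ ψ ^ 2 * (1 + ε) * Q := by gcongr
  have h1 : lam * (2 * ψ * F 1 * m) ≤ lam * ((1 + ε)⁻¹ * F 1 ^ 2 + ψ ^ 2 * (1 + ε) * Q) := by
    gcongr
    linarith
  have h2 : lam * δ / 2 * m ^ 2 ≤ lam * δ / 2 * Q := by gcongr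
  have h3 : lam * δ / 2 * ((1 + ε)⁻¹ * V) ≤ lam * δ / 2 * Q := by gcongr
  have e3 : -(lam * δ / (2 * (1 + ε))) * V = -(lam * δ / 2 * ((1 + ε)⁻¹ * V)) := by
    field_simp
  have e1 : 2 * (-(lam * J) + c * m) = -(lam * (2 * J)) + lam * (2 * ψ * F 1 * m) + 2 * b * m := by
    rw [hc]; ring
  have e2 : lam * δ * Q = lam * Q - lam * (ψ ^ 2 * (1 + ε) * Q) := by rw [hδd]; ring
  rw [e1, e3, hibp]
  linarith

/-! ### Exponential decay -/

section ExpDecay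

variable {E F : Type*} [NormedAddCommGroup E] [NormedAddCommGroup F]

theorem ExpDecay.of_le {f : ℝ → E} {g : ℝ → F} (hg : ExpDecay g) (C : ℝ) (hC : 0 ≤ C)
    (h : ∀ t, 0 ≤ t → ‖f t‖ ≤ C * ‖g t‖) : ExpDecay f := by
  obtain ⟨M, α, hα, hM⟩ := hg
  refine ⟨C * M, α, hα, fun t ht => (h t ht).trans ?_⟩
  rw [mul_assoc]
  exact mul_le_mul_of_nonneg_left (hM t ht) hC

theorem ExpDecay.clm_comp [NormedSpace ℝ E] [NormedSpace ℝ F] {f : ℝ → E} (hf : ExpDecay f)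
    (A : E →L[ℝ] F) : ExpDecay (fun t => A (f t)) :=
  hf.of_le ‖A‖ (norm_nonneg _) fun t _ => A.le_opNorm (f t)

theorem ExpDecay.add {f g : ℝ → E} (hf : ExpDecay f) (hg : ExpDecay g) :
    ExpDecay (fun t => f t + g t) := by
  obtain ⟨M, α, hα, hM⟩ := hf
  obtain ⟨N, β, hβ, hN⟩ := hg
  have hM0 : 0 ≤ M := by simpa using (norm_nonneg _).trans (hM 0 le_rfl)
  have hN0 : 0 ≤ N := by simpa using (norm_nonneg _).trans (hN 0 le_rfl)
  refine ⟨M + N, min α β, lt_min hα hβ, fun t ht => (norm_add_le _ _).trans ?_⟩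
  rw [add_mul]
  refine add_le_add ((hM t ht).trans ?_) ((hN t ht).trans ?_)
  · gcongr
    exact min_le_left _ _
  · gcongr
    exact min_le_right _ _

theorem ExpDecay.of_sq_norm {f : ℝ → E} (h : ExpDecay (fun t => ‖f t‖ ^ 2)) : ExpDecay f := by
  obtain ⟨M, α, hα, hM⟩ := h
  have hM0 : 0 ≤ M := by simpa using (norm_nonneg _).trans (hM 0 le_rfl)
  refine ⟨√M, α / 2, half_pos hα, fun t ht => ?_⟩
  refine abs_le_of_sq_le_sq' ?_ (by positivity) |>.2
  have := hM t ht
  rw [Real.norm_of_nonneg (sq_nonneg _)] at this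
  rw [mul_pow, Real.sq_sqrt hM0, ← Real.exp_nat_mul,
    show ((2 : ℕ) : ℝ) * -(α / 2 * t) = -(α * t) by push_cast; ring]
  exact this

/-- A nonnegative function `V` with `V' ≤ -c V + C ‖b‖²` decays exponentially if `b` does: for
`κ ≤ c` and `κ` at most the decay rate `α` of `b`, the function
`exp (κ t) V(t) + (C M² / α) exp (-α t)` is nonincreasing. -/
theorem ExpDecay.of_hasDerivAt_le {V V' : ℝ → ℝ} {b : ℝ → E} {c C : ℝ} (hc : 0 < c) (hC : 0 ≤ C)
    (hb : ExpDecay b) (hV0 : ∀ t, 0 ≤ V t) (hV : ContinuousOn V (Ici 0))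
    (hd : ∀ t, 0 < t → HasDerivAt V (V' t) t)
    (hle : ∀ t, 0 < t → V' t ≤ -c * V t + C * ‖b t‖ ^ 2) : ExpDecay V := by
  obtain ⟨M, α, hα, hM⟩ := hb
  set κ := min c α
  have hκ : 0 < κ := lt_min hc hα
  set N := C * M ^ 2 / α
  have hN : 0 ≤ N := by positivity
  let W : ℝ → ℝ := fun t => Real.exp (κ * t) * V t + N * Real.exp (-(α * t))
  have hWd : ∀ t, 0 < t → HasDerivAt W (Real.exp (κ * t) * κ * V t + Real.exp (κ * t) * V' t
      + N * (Real.exp (-(α * t)) * -α)) t := by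
    intro t ht
    have h1 : HasDerivAt (fun t => Real.exp (κ * t)) (Real.exp (κ * t) * κ) t := by
      simpa using ((hasDerivAt_id t).const_mul κ).exp
    have h2 : HasDerivAt (fun t => Real.exp (-(α * t))) (Real.exp (-(α * t)) * -α) t := by
      simpa using ((hasDerivAt_id t).const_mul α).neg.exp
    exact (h1.mul (hd t ht)).add (h2.const_mul N)
  have hW : AntitoneOn W (Ici 0) := by
    refine antitoneOn_of_deriv_nonpos (convex_Ici 0) ?_ ?_ ?_
    · exact ((by fun_prop : Continuous fun t => Real.exp (κ * t)).continuousOn.mul hV).add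
        (by fun_prop)
    · rw [interior_Ici]
      exact fun t ht => (hWd t ht).differentiableAt.differentiableWithinAt
    · rw [interior_Ici]
      intro t ht
      have ht' : 0 < t := ht
      rw [(hWd t ht).deriv]
      have h1 : κ * V t + V' t ≤ C * (M * Real.exp (-(α * t))) ^ 2 := by
        have h2 : κ * V t ≤ c * V t := mul_le_mul_of_nonneg_right (min_le_left _ _) (hV0 t)
        have h3 : C * ‖b t‖ ^ 2 ≤ C * (M * Real.exp (-(α * t))) ^ 2 := by
          gcongr
          exact hM t ht'.le
        linarith [hle t ht]
      have h2 : Real.exp (κ * t) * (M * Real.exp (-(α * t))) ^ 2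
          ≤ M ^ 2 * Real.exp (-(α * t)) := by
        have e : Real.exp (κ * t) * (M * Real.exp (-(α * t))) ^ 2
            = M ^ 2 * Real.exp (κ * t - 2 * (α * t)) := by
          rw [mul_pow, ← Real.exp_nat_mul, mul_left_comm, ← Real.exp_add]
          congr 2
          push_cast
          ring
        rw [e]
        gcongr
        have : κ * t ≤ α * t := mul_le_mul_of_nonneg_right (min_le_right _ _) ht'.le
        linarith
      have h3 := mul_le_mul_of_nonneg_left h1 (Real.exp_pos (κ * t)).le
      have h4 := mul_le_mul_of_nonneg_left h2 hC
      have h5 : N * (Real.exp (-(α * t)) * -α) = -(C * (M ^ 2 * Real.exp (-(α * t)))) := by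
        simp only [N]
        field_simp
      rw [h5]
      linarith
  refine ⟨W 0, κ, hκ, fun t ht => ?_⟩
  have h := hW self_mem_Ici ht ht
  rw [Real.norm_of_nonneg (hV0 t)]
  have h1 : Real.exp (κ * t) * V t ≤ W 0 := by
    refine le_trans ?_ h
    simp only [W]
    have := Real.exp_pos (-(α * t))
    nlinarith
  calc V t = Real.exp (κ * t) * V t * Real.exp (-(κ * t)) := by
        rw [mul_right_comm, ← Real.exp_add]; simp
    _ ≤ W 0 * Real.exp (-(κ * t)) := by gcongr

end ExpDecay

/-! ### The scalar transport equation -/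

theorem memLp_top_sqrt_inv_add {ε : ℝ} (hε : 0 < ε) :
    MemLp (fun x => √((x + ε)⁻¹)) ⊤ mu := by
  refine memLp_top_of_bound ?_ √(ε⁻¹) ?_
  · exact Measurable.aestronglyMeasurable (by fun_prop)
  · filter_upwards [ae_restrict_mem measurableSet_Ioo] with x hx
    rw [Real.norm_of_nonneg (Real.sqrt_nonneg _)]
    exact Real.sqrt_le_sqrt (inv_anti₀ hε (by linarith [hx.1]))

/-- Multiplication by `√w`, `w(x) = (x + ε)⁻¹`, as a bounded operator on `L²(0,1)`. The weighted
energy `∫ w y²` is then `‖√w y‖²`. -/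
noncomputable def sqrtWeightMul {ε : ℝ} (hε : 0 < ε) : Lp ℝ 2 mu →L[ℝ] Lp ℝ 2 mu :=
  (ContinuousLinearMap.mul ℝ ℝ).holderL mu ⊤ 2 2 (memLp_top_sqrt_inv_add hε).toLp

theorem coeFn_sqrtWeightMul {ε : ℝ} (hε : 0 < ε) (f : Lp ℝ 2 mu) :
    ∀ᵐ x ∂mu, sqrtWeightMul hε f x = √((x + ε)⁻¹) * f x := by
  have h := (ContinuousLinearMap.mul ℝ ℝ).coeFn_holder (r := 2)
    ((memLp_top_sqrt_inv_add hε).toLp) f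
  filter_upwards [h, (memLp_top_sqrt_inv_add hε).coeFn_toLp] with x hx hx'
  rw [hx'] at hx
  exact hx

theorem inner_sqrtWeightMul {ε : ℝ} (hε : 0 < ε) (f g : Lp ℝ 2 mu) :
    inner ℝ (sqrtWeightMul hε f) (sqrtWeightMul hε g) = ∫ x, (x + ε)⁻¹ * f x * g x ∂mu := by
  rw [L2.inner_def]
  apply integral_congr_ae
  filter_upwards [coeFn_sqrtWeightMul hε f, coeFn_sqrtWeightMul hε g,
    ae_restrict_mem measurableSet_Ioo] with x hf hg hx
  rw [hf, hg]
  have h : √((x + ε)⁻¹) * √((x + ε)⁻¹) = (x + ε)⁻¹ :=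
    Real.mul_self_sqrt (inv_nonneg.2 (by linarith [hx.1]))
  simp only [RCLike.inner_apply, conj_trivial]
  linear_combination (f x * g x) * h

theorem sq_norm_le_sq_norm_sqrtWeightMul {ε : ℝ} (hε : 0 < ε) (f : Lp ℝ 2 mu) :
    ‖f‖ ^ 2 ≤ (1 + ε) * ‖sqrtWeightMul hε f‖ ^ 2 := by
  rw [← real_inner_self_eq_norm_sq, ← real_inner_self_eq_norm_sq, L2.inner_def, L2.inner_def,
    ← integral_const_mul]
  refine integral_mono_ae (L2.integrable_inner f f)
    ((L2.integrable_inner _ _).const_mul _) ?_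
  filter_upwards [coeFn_sqrtWeightMul hε f, ae_restrict_mem measurableSet_Ioo] with x hf hx
  rw [hf]
  have hx0 : 0 < x + ε := by linarith [hx.1]
  have h : √((x + ε)⁻¹) * √((x + ε)⁻¹) = (x + ε)⁻¹ := Real.mul_self_sqrt (inv_nonneg.2 hx0.le)
  simp only [RCLike.inner_apply, conj_trivial]
  have h1 : 1 ≤ (1 + ε) * (x + ε)⁻¹ := by
    rw [← div_eq_mul_inv, one_le_div hx0]
    linarith [hx.2]
  calc f x * f x ≤ (1 + ε) * (x + ε)⁻¹ * (f x * f x) :=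
        le_mul_of_one_le_left (mul_self_nonneg _) h1
    _ = (1 + ε) * (√((x + ε)⁻¹) * f x * (√((x + ε)⁻¹) * f x)) := by
        linear_combination -((1 + ε) * f x ^ 2) * h

/-- Exponential input-to-state stability of the transport equation
`y_t + λ y_x = λ ψ y(1,t) + b(t)`, `y(0,t) = 0`, for `0 ≤ ψ < 1`. Here `g t` is the spatial derivative
of `y t`, and `y(x,t) = ∫₀ˣ g t`. -/
theorem expDecay_transport {lam ψ : ℝ} (hlam : 0 < lam) (hψ0 : 0 ≤ ψ) (hψ1 : ψ < 1)
    {y g : ℝ → Lp ℝ 2 mu} {b : ℝ → ℝ} (hb : ExpDecay b) (hy : ContinuousOn y (Ici 0))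
    (hyg : ∀ t, 0 < t → ∀ᵐ x ∂mu, y t x = ∫ s in (0 : ℝ)..x, g t s)
    (hd : ∀ t, 0 < t → HasDerivAt y
      (-(lam • g t) + Lp.const 2 mu (lam * ψ * (∫ s in (0 : ℝ)..1, g t s) + b t)) t) :
    ExpDecay y := by
  have hψ2 : 0 < 1 - ψ ^ 2 := by nlinarith
  -- `ψ ^ 2 * (1 + ε) = ψ ^ 2 * (2 - ψ ^ 2) < 1`
  obtain ⟨ε, hε, hδ⟩ : ∃ ε : ℝ, 0 < ε ∧ 0 < 1 - ψ ^ 2 * (1 + ε) :=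
    ⟨1 - ψ ^ 2, hψ2, by nlinarith [pow_pos hψ2 2]⟩
  have hSy : ContinuousOn (fun t => sqrtWeightMul hε (y t)) (Ici 0) :=
    (sqrtWeightMul hε).continuous.comp_continuousOn hy
  have hV : ExpDecay (fun t => ‖sqrtWeightMul hε (y t)‖ ^ 2) := by
    refine ExpDecay.of_hasDerivAt_le (c := lam * (1 - ψ ^ 2 * (1 + ε)) / (2 * (1 + ε)))
      (C := 2 / (lam * (1 - ψ ^ 2 * (1 + ε)))) (by positivity) (by positivity) hb
      (fun t => sq_nonneg _) (hSy.norm.pow 2)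
      (fun t ht => ((sqrtWeightMul hε).hasFDerivAt.comp_hasDerivAt t (hd t ht)).norm_sq) ?_
    intro t ht
    have hg : Integrable (g t) mu := (Lp.memLp (g t)).integrable (by norm_num)
    have h := weighted_energy_rate_le (b := b t) hlam hε hδ hg
    have e1 : inner ℝ (sqrtWeightMul hε (y t)) (sqrtWeightMul hε
          (-(lam • g t) + Lp.const 2 mu (lam * ψ * (∫ s in (0 : ℝ)..1, g t s) + b t)))
        = ∫ x, (x + ε)⁻¹ * (∫ s in (0 : ℝ)..x, g t s)
          * (-(lam * g t x) + (lam * ψ * (∫ s in (0 : ℝ)..1, g t s) + b t)) ∂mu := by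
      rw [inner_sqrtWeightMul]
      apply integral_congr_ae
      filter_upwards [hyg t ht, Lp.coeFn_add (-(lam • g t))
          (Lp.const 2 mu (lam * ψ * (∫ s in (0 : ℝ)..1, g t s) + b t)),
        Lp.coeFn_neg (lam • g t), Lp.coeFn_smul lam (g t),
        Lp.coeFn_const (p := 2) (μ := mu) (lam * ψ * (∫ s in (0 : ℝ)..1, g t s) + b t)]
        with x h1 h2 h3 h4 h5
      rw [h1, h2, Pi.add_apply, h3, Pi.neg_apply, h4, h5]
      rfl
    have e2 : ‖sqrtWeightMul hε (y t)‖ ^ 2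
        = ∫ x, (x + ε)⁻¹ * (∫ s in (0 : ℝ)..x, g t s) ^ 2 ∂mu := by
      rw [← real_inner_self_eq_norm_sq, inner_sqrtWeightMul]
      apply integral_congr_ae
      filter_upwards [hyg t ht] with x h1
      rw [h1]
      ring
    rw [e2, Real.norm_eq_abs, sq_abs]
    refine le_trans (le_of_eq ?_) h
    rw [← e1]
    rfl
  refine ExpDecay.of_sq_norm (hV.of_le (1 + ε) (by linarith) fun t _ => ?_)
  rw [Real.norm_of_nonneg (sq_nonneg _), Real.norm_of_nonneg (sq_nonneg _)]
  exact sq_norm_le_sq_norm_sqrtWeightMul hε (y t)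

/-! ### Components of the error system -/

/-- The `i`-th component of an `ℝ²`-valued function in `L²`. -/
noncomputable def component (i : Fin 2) : L2 →L[ℝ] Lp ℝ 2 mu :=
  (EuclideanSpace.proj (𝕜 := ℝ) i).compLpL 2 mu

theorem coeFn_component (i : Fin 2) (f : L2) : ∀ᵐ x ∂mu, component i f x = f x i :=
  (EuclideanSpace.proj (𝕜 := ℝ) i).coeFn_compLpL f

/-- The `ℝ²`-valued function in `L²` with `i`-th component `f` and the other component `0`. -/
noncomputable def ofComponent (i : Fin 2) : Lp ℝ 2 mu →L[ℝ] L2 :=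
  ((1 : ℝ →L[ℝ] ℝ).smulRight (EuclideanSpace.single i (1 : ℝ))).compLpL 2 mu

theorem coeFn_ofComponent (i : Fin 2) (f : Lp ℝ 2 mu) :
    ∀ᵐ x ∂mu, ofComponent i f x = f x • EuclideanSpace.single i (1 : ℝ) :=
  ((1 : ℝ →L[ℝ] ℝ).smulRight (EuclideanSpace.single i (1 : ℝ))).coeFn_compLpL f

theorem ofComponent_add_ofComponent (f : L2) :
    ofComponent 0 (component 0 f) + ofComponent 1 (component 1 f) = f := by
  apply Lp.ext
  filter_upwards [Lp.coeFn_add (ofComponent 0 (component 0 f)) (ofComponent 1 (component 1 f)),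
    coeFn_ofComponent 0 (component 0 f), coeFn_ofComponent 1 (component 1 f),
    coeFn_component 0 f, coeFn_component 1 f] with x h h0 h1 h2 h3
  rw [h, Pi.add_apply, h0, h1, h2, h3]
  ext j
  fin_cases j <;> simp

namespace Params

variable (p : Params)

/-- The transport velocity of the `i`-th axle. -/
noncomputable def vel : Fin 2 → ℝ := ![p.vx / p.L₁, p.vx / p.L₂]

/-- The carcass parameters `ψᵢ` as a vector. -/
noncomputable def psi : Fin 2 → ℝ := ![p.ψ₁, p.ψ₂]

theorem vel_pos (i : Fin 2) : 0 < p.vel i := by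
  fin_cases i
  · exact div_pos p.vx_pos p.L₁_pos
  · exact div_pos p.vx_pos p.L₂_pos

theorem psi_mem (i : Fin 2) : p.psi i ∈ Ico (0 : ℝ) 1 := by
  fin_cases i
  · exact p.ψ₁_mem
  · exact p.ψ₂_mem

theorem act_Lam_apply (v : R2) (i : Fin 2) : act p.Lam v i = p.vel i * v i := by
  fin_cases i <;> simp [Lam, vel, Matrix.ofLp_toEuclideanCLM, Matrix.mulVec, dotProduct]

theorem act_K2mat_apply (v : R2) (i : Fin 2) :
    act p.K2mat v i = p.vel i * p.psi i * v i := by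
  fin_cases i <;> simp [K2mat, vel, psi, Matrix.ofLp_toEuclideanCLM, Matrix.mulVec, dotProduct]  <;>
    exact Or.inl (by ring)

end Params

theorem component_rhs (p : Params) (g : L2) (a b : R2) (i : Fin 2) :
    component i (-((act p.Lam).compLp g) + Lp.const 2 mu (act p.K2mat a + b))
      = -(p.vel i • component i g) + Lp.const 2 mu (p.vel i * p.psi i * a i + b i) := by
  apply Lp.ext
  filter_upwards [coeFn_component i (-((act p.Lam).compLp g) + Lp.const 2 mu (act p.K2mat a + b)),
    Lp.coeFn_add (-((act p.Lam).compLp g)) (Lp.const 2 mu (act p.K2mat a + b)),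
    Lp.coeFn_neg ((act p.Lam).compLp g), (act p.Lam).coeFn_compLp g,
    Lp.coeFn_const (p := 2) (μ := mu) (act p.K2mat a + b),
    Lp.coeFn_add (-(p.vel i • component i g)) (Lp.const 2 mu (p.vel i * p.psi i * a i + b i)),
    Lp.coeFn_neg (p.vel i • component i g), Lp.coeFn_smul (p.vel i) (component i g),
    coeFn_component i g,
    Lp.coeFn_const (p := 2) (μ := mu) (p.vel i * p.psi i * a i + b i)]
    with x h1 h2 h3 h4 h5 h6 h7 h8 h9 h10
  rw [h1, h2, h6, Pi.add_apply, Pi.add_apply, h3, h7, Pi.neg_apply, Pi.neg_apply, h4, h8,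
    Pi.smul_apply, h9, h5, h10]
  simp [p.act_Lam_apply, p.act_K2mat_apply]

theorem evalAt_apply_eq_integral {ζ : H1} (h0 : evalAt ζ 0 = 0) {x : ℝ} (hx : x ∈ Icc (0 : ℝ) 1)
    (i : Fin 2) : evalAt ζ x i = ∫ y in (0 : ℝ)..x, component i (dxi ζ) y := by
  have hg : Integrable (dxi ζ) mu := (Lp.memLp (dxi ζ)).integrable (by norm_num)
  have hle : volume.restrict (Ioc 0 x) ≤ mu := by
    rw [mu, restrict_Ioo_eq_restrict_Ioc]
    exact Measure.restrict_mono (Ioc_subset_Ioc_right hx.2) le_rfl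
  rw [evalAt_eq_integral_dxi h0 hx, intervalIntegral.integral_of_le hx.1,
    intervalIntegral.integral_of_le hx.1]
  change EuclideanSpace.proj (𝕜 := ℝ) i (∫ y in Ioc 0 x, dxi ζ y) = _
  rw [← ContinuousLinearMap.integral_comp_comm _ (hg.mono_measure hle)]
  apply integral_congr_ae
  filter_upwards [ae_mono hle (coeFn_component i (dxi ζ))] with y hy
  rw [hy]
  rfl

end SingleTrack

theorem lemma1 (p : SingleTrack.Params)
    (D : Matrix (Fin 2) (Fin 2) ℝ) (H : ℝ → Matrix (Fin 2) (Fin 2) ℝ)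
    (hH : ∀ i j, LocallyIntegrableOn (fun t => H t i j) (Ici 0))
    (u₀ : SingleTrack.StateY) (hu₀ : SingleTrack.evalAt u₀.snd 0 = 0)
    (u : ℝ → SingleTrack.StateY) (hu : SingleTrack.IsClassicalSolution p D H u)
    (hinit : u 0 = u₀)
    (hX : SingleTrack.ExpDecay (fun t => (u t).fst)) :
    SingleTrack.ExpDecay (fun t => SingleTrack.incl (u t)) := by
  open SingleTrack in
  have hzc : ContinuousOn (fun t => toL2 (u t).snd) (Ici 0) :=
    (WithLp.sndL 2 ℝ R2 L2).continuous.comp_continuousOn hu.contDiffOn.continuousOn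
  have hcomp : ∀ i, ExpDecay (fun t => component i (toL2 (u t).snd)) := by
    intro i
    refine expDecay_transport (g := fun t => component i (dxi (u t).snd))
      (b := fun t => act p.A2 (u t).fst i) (p.vel_pos i) (p.psi_mem i).1
      (p.psi_mem i).2 ?_ ?_ ?_ ?_
    · exact (hX.clm_comp (act p.A2)).clm_comp (EuclideanSpace.proj (𝕜 := ℝ) i)
    · exact (component i).continuous.comp_continuousOn hzc
    · intro t ht
      filter_upwards [coeFn_component i (toL2 (u t).snd), toL2_ae_eq_evalAt (u t).snd,
        ae_restrict_mem measurableSet_Ioo] with x h1 h2 hx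
      rw [h1, h2, evalAt_apply_eq_integral (hu.bc t ht) (Ioo_subset_Icc_self hx)]
    · intro t ht
      have h := (component i).hasFDerivAt.comp_hasDerivAt t (hu.pde t ht)
      rw [Params.K2, component_rhs,
        evalAt_apply_eq_integral (hu.bc t ht) (right_mem_Icc.2 zero_le_one)] at h
      exact h
  have hz : ExpDecay (fun t => toL2 (u t).snd) := by
    have h := ((hcomp 0).clm_comp (ofComponent 0)).add ((hcomp 1).clm_comp (ofComponent 1))
    simpa only [ofComponent_add_ofComponent] using h
  have h1 : ExpDecay (fun t => (WithLp.toLp 2 ((u t).fst, (0 : L2)) : StateX)) :=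
    hX.of_le 1 zero_le_one fun t _ => by rw [one_mul, WithLp.norm_toLp_fst]
  have h2 : ExpDecay (fun t => (WithLp.toLp 2 ((0 : R2), toL2 (u t).snd) : StateX)) :=
    hz.of_le 1 zero_le_one fun t _ => by rw [one_mul, WithLp.norm_toLp_snd]
  refine (h1.add h2).of_le 1 zero_le_one fun t _ => ?_
  rw [one_mul, ← WithLp.toLp_add]
  simp [incl]
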